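/- All systems are finite-dimensional. For a state $\rho_{AB}$, let $\mathcal F(\rho_{AB})$ be the set of all states $\operatorname{Tr}_B[\omega_{ABB'}]$, where $\omega_{ABB'}$ is a state with $B'\cong B$ and $\operatorname{Tr}_{B'}[\omega_{ABB'}]=\rho_{AB}$. Call $\rho_{AB}$ super two-extendible if there is $\sigma\in\mathcal F(\rho_{AB})$ with $\operatorname{supp}\sigma\subseteq\operatorname{supp}\rho_{AB}$. A one-way LOCC channel (from Alice to Bob) is a finite sum $\sum_x\mathcal E_x\otimes\mathcal D_x$ with $\mathcal E_x$ completely positive, $\sum_x\mathcal E_x$ trace preserving and every $\mathcal D_x$ completely positive and trace preserving. A private state of $\log_2 k$ bits is a state $$\gamma^k=\frac1k\sum_{i,j=0}^{k-1}|ii\rangle\langle jj|_{A_0B_0}\otimes U_i\,\omega_{A_1B_1}U_j^\dagger$$ with $\omega_{A_1B_1}$ a state and $U_0,\dots,U_{k-1}$ unitaries on $A_1B_1$; put $A'=A_0A_1$, $B'=B_0B_1$ below. The one-shot probabilistic one-way distillable secret key $K_D^{(1),\to}(\rho_{AB})$ is the supremum of $p\log_2 k$ over all $p\in[0,1]$,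 integers $k\ge1$, private states $\gamma^k_{A'B'}$ and one-way LOCC channels $\mathcal L_{AB\to X_AA'B'}$, with $X_A$ a binary flag held by Alice, such that $$\mathcal L(\rho_{AB})=p\,|1\rangle\langle1|_{X_A}\otimes\gamma^k_{A'B'}+(1-p)\,|0\rangle\langle0|_{X_A}\otimes\frac{I_{A'B'}}{d_{A'}d_{B'}},$$ and the probabilistic one-way distillable secret key is $K_D^{\to}(\rho_{AB})=\liminf_{n\to\infty}\frac1nK_D^{(1),\to}(\rho_{AB}^{\otimes n})$. Let $\rho_{AB}$ be a full-rank state. Then $\rho_{AB}\otimes I_{B'}/d_B$ is an extension of $\rho_{AB}$ whose marginal on $AB'$ has support contained in $\operatorname{supp}\rho_{AB}$; in particular $\rho_{AB}$ is super two-extendible. Moreover $K_D^{\to}(\rho_{AB})=0$. For example, for every integer $d\ge2$, all $0<p<1$ and all $0<F<1$, the Werner state $$W^{p,d}=p\,\frac{I+S}{d(d+1)}+(1-p)\,\frac{I-S}{d(d-1)},\qquad S=\sum_{i,j}|i\rangle\langle j|\otimes|j\rangle\langle i|,$$ and the isotropic state $$\zeta^{F,d}=F\,\Phi^d+(1-F)\,\frac{I-\Phi^d}{d^2-1},\qquad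 \Phi^d=\frac1d\sum_{i,j}|i\rangle\langle j|\otimes|i\rangle\langle j|,$$ are full-rank states, hence super two-extendible with $K_D^{\to}(W^{p,d})=K_D^{\to}(\zeta^{F,d})=0$. -/

import Mathlib

open Matrix
open scoped Kronecker ComplexOrder

noncomputable section

namespace OneWayKey

/-! ### States, partial traces, supports -/

/-- A density operator on the finite-dimensional Hilbert space with orthonormal basis indexed by
`n`. -/
def IsState {n : Type*} [Fintype n] (ρ : Matrix n n ℂ) : Prop :=
  ρ.PosSemidef ∧ ρ.trace = 1

/-- A density operator whose rank is the dimension of the underlying space. -/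
def IsFullRankState {n : Type*} [Fintype n] (ρ : Matrix n n ℂ) : Prop :=
  IsState ρ ∧ ρ.rank = Fintype.card n

/-- The support of a Hermitian operator, i.e. its range. -/
def supp {n : Type*} [Fintype n] (ρ : Matrix n n ℂ) : Submodule ℂ (n → ℂ) :=
  LinearMap.range ρ.mulVecLin

/-- Partial trace over the last system, `S ⊗ T → S`. -/
def trLast {s t : Type*} [Fintype t] (M : Matrix (s × t) (s × t) ℂ) : Matrix s s ℂ :=
  Matrix.of fun i j => ∑ x, M (i, x) (j, x)

/-- Partial trace over the middle system, `(A ⊗ B) ⊗ B' → A ⊗ B'`. -/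
def trMiddle {a b c : Type*} [Fintype b] (M : Matrix ((a × b) × c) ((a × b) × c) ℂ) :
    Matrix (a × c) (a × c) ℂ :=
  Matrix.of fun i j => ∑ y, M ((i.1, y), i.2) ((j.1, y), j.2)

/-- The maximally mixed state `I / d`. -/
def maxMixed (n : Type*) [Fintype n] [DecidableEq n] : Matrix n n ℂ :=
  (Fintype.card n : ℂ)⁻¹ • (1 : Matrix n n ℂ)

/-! ### Super two-extendible states -/

/-- `ω` on `(A ⊗ B) ⊗ B'`, with `B'` a copy of `B`, is an extension of the state `ρ` on `A ⊗ B`. -/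
def IsExtension {a b : Type*} [Fintype a] [Fintype b]
    (ρ : Matrix (a × b) (a × b) ℂ) (ω : Matrix ((a × b) × b) ((a × b) × b) ℂ) : Prop :=
  IsState ω ∧ trLast ω = ρ

/-- The set `𝓕(ρ)` of all marginals on `A ⊗ B'` of extensions of `ρ`. -/
def extensionSet {a b : Type*} [Fintype a] [Fintype b]
    (ρ : Matrix (a × b) (a × b) ℂ) : Set (Matrix (a × b) (a × b) ℂ) :=
  {σ | ∃ ω, IsExtension ρ ω ∧ trMiddle ω = σ}

/-- `ρ` is super two-extendible: some `σ ∈ 𝓕(ρ)` has support inside the support of `ρ`. -/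
def IsSuperTwoExtendible {a b : Type*} [Fintype a] [Fintype b]
    (ρ : Matrix (a × b) (a × b) ℂ) : Prop :=
  ∃ σ ∈ extensionSet ρ, supp σ ≤ supp ρ

/-! ### Quantum channels and one-way LOCC channels -/

/-- The map `Φ ⊗ id` on operators of `A ⊗ C`. -/
def mapLeft {a a' : Type*} (c : Type*) (Φ : Matrix a a ℂ →ₗ[ℂ] Matrix a' a' ℂ) :
    Matrix (a × c) (a × c) ℂ →ₗ[ℂ] Matrix (a' × c) (a' × c) ℂ where
  toFun M := Matrix.of fun p q => Φ (Matrix.of fun i j => M (i, p.2) (j, q.2)) p.1 q.1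
  map_add' M N := by
    ext p q
    exact congrFun (congrFun (Φ.map_add (Matrix.of fun i j => M (i, p.2) (j, q.2))
      (Matrix.of fun i j => N (i, p.2) (j, q.2))) p.1) q.1
  map_smul' r M := by
    ext p q
    exact congrFun (congrFun (Φ.map_smul r (Matrix.of fun i j => M (i, p.2) (j, q.2))) p.1) q.1

/-- The map `id ⊗ Φ` on operators of `C ⊗ B`. -/
def mapRight {b b' : Type*} (c : Type*) (Φ : Matrix b b ℂ →ₗ[ℂ] Matrix b' b' ℂ) :
    Matrix (c × b) (c × b) ℂ →ₗ[ℂ] Matrix (c × b') (c × b') ℂ where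
  toFun M := Matrix.of fun p q => Φ (Matrix.of fun i j => M (p.1, i) (q.1, j)) p.2 q.2
  map_add' M N := by
    ext p q
    exact congrFun (congrFun (Φ.map_add (Matrix.of fun i j => M (p.1, i) (q.1, j))
      (Matrix.of fun i j => N (p.1, i) (q.1, j))) p.2) q.2
  map_smul' r M := by
    ext p q
    exact congrFun (congrFun (Φ.map_smul r (Matrix.of fun i j => M (p.1, i) (q.1, j))) p.2) q.2

/-- The tensor product `Φ ⊗ Ψ = (id ⊗ Ψ) ∘ (Φ ⊗ id)` of two linear maps on operators. -/
def tensorMap {a b a' b' : Type*} (Φ : Matrix a a ℂ →ₗ[ℂ] Matrix a' a' ℂ)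
    (Ψ : Matrix b b ℂ →ₗ[ℂ] Matrix b' b' ℂ) :
    Matrix (a × b) (a × b) ℂ →ₗ[ℂ] Matrix (a' × b') (a' × b') ℂ :=
  mapRight a' Ψ ∘ₗ mapLeft b Φ

/-- Complete positivity: every `id_r ⊗ Φ` preserves positive semidefiniteness. -/
def IsCP {n m : Type*} (Φ : Matrix n n ℂ →ₗ[ℂ] Matrix m m ℂ) : Prop :=
  ∀ (r : ℕ) (M : Matrix (Fin r × n) (Fin r × n) ℂ),
    M.PosSemidef → (mapRight (Fin r) Φ M).PosSemidef

/-- Trace preservation. -/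
def IsTP {n m : Type*} [Fintype n] [Fintype m] (Φ : Matrix n n ℂ →ₗ[ℂ] Matrix m m ℂ) : Prop :=
  ∀ M, (Φ M).trace = M.trace

/-- A one-way LOCC channel from Alice to Bob: Alice applies a quantum instrument `(E x)`, sends
the outcome `x` to Bob, and Bob applies a channel `D x`. -/
def IsOneWayLOCC {a b a' b' : Type*} [Fintype a] [Fintype b] [Fintype a'] [Fintype b']
    (L : Matrix (a × b) (a × b) ℂ →ₗ[ℂ] Matrix (a' × b') (a' × b') ℂ) : Prop :=
  ∃ (m : ℕ) (E : Fin m → (Matrix a a ℂ →ₗ[ℂ] Matrix a' a' ℂ))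
    (D : Fin m → (Matrix b b ℂ →ₗ[ℂ] Matrix b' b' ℂ)),
    (∀ x, IsCP (E x)) ∧ IsTP (∑ x, E x) ∧
    (∀ x, IsCP (D x) ∧ IsTP (D x)) ∧
    L = ∑ x, tensorMap (E x) (D x)

/-! ### Private states and distillable key -/

/-- The operator `(1/k) ∑ i j, |ii⟩⟨jj|_{A₀B₀} ⊗ (U i) ω (U j)†_{A₁B₁}`, with the systems grouped
as `A = A₀A₁` and `B = B₀B₁`; the key systems have dimension `k` and the shield systems `A₁`, `B₁`
have dimensions `s`, `t`. -/
def privateOp {k s t : ℕ} (U : Fin k → Matrix.unitaryGroup (Fin s × Fin t) ℂ)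
    (ω : Matrix (Fin s × Fin t) (Fin s × Fin t) ℂ) :
    Matrix ((Fin k × Fin s) × (Fin k × Fin t)) ((Fin k × Fin s) × (Fin k × Fin t)) ℂ :=
  (k : ℂ)⁻¹ • ∑ i : Fin k, ∑ j : Fin k,
    (Matrix.single (i, i) (j, j) (1 : ℂ) ⊗ₖ
        ((U i : Matrix _ _ ℂ) * ω * (U j : Matrix _ _ ℂ)ᴴ)).submatrix
      (Equiv.prodProdProdComm (Fin k) (Fin s) (Fin k) (Fin t))
      (Equiv.prodProdProdComm (Fin k) (Fin s) (Fin k) (Fin t))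

/-- `γ` is a bipartite private state holding `log₂ k` secret key bits. -/
def IsPrivateState {k s t : ℕ}
    (γ : Matrix ((Fin k × Fin s) × (Fin k × Fin t)) ((Fin k × Fin s) × (Fin k × Fin t)) ℂ) :
    Prop :=
  ∃ (U : Fin k → Matrix.unitaryGroup (Fin s × Fin t) ℂ)
    (ω : Matrix (Fin s × Fin t) (Fin s × Fin t) ℂ), IsState ω ∧ γ = privateOp U ω

/-- `|x⟩⟨x|_X ⊗ τ`, with the flag `X` held by Alice, i.e. as an operator on `(X ⊗ A) ⊗ B`. -/
def flagged {a b : Type*} (x : Fin 2) (τ : Matrix (a × b) (a × b) ℂ) :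
    Matrix ((Fin 2 × a) × b) ((Fin 2 × a) × b) ℂ :=
  (Matrix.single x x (1 : ℂ) ⊗ₖ τ).submatrix (Equiv.prodAssoc (Fin 2) a b)
    (Equiv.prodAssoc (Fin 2) a b)

/-- The expected numbers `p log₂ k` of key bits that one-way LOCC channels distill from one copy
of `ρ`: with probability `p` the output is a private state of `log₂ k` bits and Alice's flag is
`1`; otherwise the flag is `0` and the output is maximally mixed. -/
def achievableKey {a b : Type*} [Fintype a] [Fintype b]
    (ρ : Matrix (a × b) (a × b) ℂ) : Set EReal :=
  {r | ∃ (p : ℝ) (k s t : ℕ)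
    (L : Matrix (a × b) (a × b) ℂ →ₗ[ℂ]
      Matrix ((Fin 2 × (Fin k × Fin s)) × (Fin k × Fin t))
        ((Fin 2 × (Fin k × Fin s)) × (Fin k × Fin t)) ℂ)
    (γ : Matrix ((Fin k × Fin s) × (Fin k × Fin t)) ((Fin k × Fin s) × (Fin k × Fin t)) ℂ),
    0 ≤ p ∧ p ≤ 1 ∧ 1 ≤ k ∧ IsOneWayLOCC L ∧ IsPrivateState γ ∧
    L ρ = (p : ℂ) • flagged 1 γ
      + ((1 - p : ℝ) : ℂ) • flagged 0 (maxMixed ((Fin k × Fin s) × (Fin k × Fin t))) ∧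
    r = ((p * Real.logb 2 k : ℝ) : EReal)}

/-- The one-shot probabilistic one-way distillable secret key. -/
def oneShotKey {a b : Type*} [Fintype a] [Fintype b]
    (ρ : Matrix (a × b) (a × b) ℂ) : EReal :=
  sSup (achievableKey ρ)

/-- The `n`-fold tensor power of `ρ`, as a bipartite operator on `Aⁿ ⊗ Bⁿ`. -/
def tensorPow {a b : Type*} (n : ℕ) (ρ : Matrix (a × b) (a × b) ℂ) :
    Matrix ((Fin n → a) × (Fin n → b)) ((Fin n → a) × (Fin n → b)) ℂ :=
  Matrix.of fun i j => ∏ l, ρ (i.1 l, i.2 l) (j.1 l, j.2 l)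

/-- The probabilistic one-way distillable secret key
`liminf_{n → ∞} (1/n) K^{(1)}(ρ^{⊗ n})`. -/
def distillableKey {a b : Type*} [Fintype a] [Fintype b]
    (ρ : Matrix (a × b) (a × b) ℂ) : EReal :=
  Filter.liminf (fun n : ℕ => ((1 / (n : ℝ) : ℝ) : EReal) * oneShotKey (tensorPow n ρ))
    Filter.atTop

/-! ### Werner and isotropic states -/

/-- The swap operator `∑ i j, |i⟩⟨j| ⊗ |j⟩⟨i|`. -/
def swapOp (d : ℕ) : Matrix (Fin d × Fin d) (Fin d × Fin d) ℂ :=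
  ∑ i, ∑ j, Matrix.single i j (1 : ℂ) ⊗ₖ Matrix.single j i (1 : ℂ)

/-- The Werner state `p (I + F) / (d (d + 1)) + (1 - p) (I - F) / (d (d - 1))`. -/
def werner (p : ℝ) (d : ℕ) : Matrix (Fin d × Fin d) (Fin d × Fin d) ℂ :=
  ((p / (d * (d + 1)) : ℝ) : ℂ) • (1 + swapOp d)
    + (((1 - p) / (d * (d - 1)) : ℝ) : ℂ) • (1 - swapOp d)

/-- The maximally entangled state `(1/d) ∑ i j, |i⟩⟨j| ⊗ |i⟩⟨j|`. -/
def maxEntangled (d : ℕ) : Matrix (Fin d × Fin d) (Fin d × Fin d) ℂ :=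
  (d : ℂ)⁻¹ • ∑ i, ∑ j, Matrix.single i j (1 : ℂ) ⊗ₖ Matrix.single i j (1 : ℂ)

/-- The isotropic state `F Φ + (1 - F) (I - Φ) / (d² - 1)`. -/
def isotropic (F : ℝ) (d : ℕ) : Matrix (Fin d × Fin d) (Fin d × Fin d) ℂ :=
  (F : ℂ) • maxEntangled d
    + (((1 - F) / ((d : ℝ) ^ 2 - 1) : ℝ) : ℂ) • (1 - maxEntangled d)

end OneWayKey

end

noncomputable section

namespace OneWayKey

/-! ### Positive semidefinite matrices -/

section PosSemidef

variable {n m : Type*} [Fintype n]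

/-! A full-rank state satisfies `c • 1 ≤ ρ ≤ C • 1` with `c > 0`, so for a positive map `L` the
outputs `L ρ` and `L 1` dominate each other up to constants. If `L` is one-way LOCC, then `L 1` is a
sum of positive product operators, because `1 = 1 ⊗ 1`. On the flag-`1` block this gives `∑ x, P x ⊗
Q x ≤ (p / c) γ`. When `k ≥ 2`, no nonzero positive product operator lies below a multiple of a
private state (`IsPrivateState.kronecker_eq_zero`), so every summand vanishes. The upper bound then
yields `p γ ≤ 0`, and the trace forces `p = 0` (`eq_zero_or_le_one_of_distill`).

Hence `p log₂ k = 0` in every protocol. Tensor powers of a positive definite matrix are positive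
definite (`posDef_tensorPow`), so the regularised quantity vanishes too. Super two-extendibility is
immediate, as the support of a full-rank state is the whole space. -/

lemma posSemidef_sub_smul_one [DecidableEq n] {A : Matrix n n ℂ} (hA : A.IsHermitian) {c : ℝ}
    (hc : ∀ i, c ≤ hA.eigenvalues i) : (A - (c : ℂ) • 1).PosSemidef := by
  have h : A - (c : ℂ) • 1 = (hA.eigenvectorUnitary : Matrix n n ℂ) *
      diagonal (fun i => ((hA.eigenvalues i - c : ℝ) : ℂ)) *
      (hA.eigenvectorUnitary : Matrix n n ℂ)ᴴ := by
    have h1 : diagonal (fun i => ((hA.eigenvalues i - c : ℝ) : ℂ)) =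
        diagonal (RCLike.ofReal ∘ hA.eigenvalues) - (c : ℂ) • (1 : Matrix n n ℂ) := by
      rw [← diagonal_one, ← diagonal_smul, diagonal_sub]
      congr 1
      ext i
      simp
    have h2 : (hA.eigenvectorUnitary : Matrix n n ℂ) * (hA.eigenvectorUnitary : Matrix n n ℂ)ᴴ
        = 1 := Unitary.coe_mul_star_self _
    conv_lhs => rw [hA.spectral_theorem]
    rw [h1, Unitary.conjStarAlgAut_apply, mul_sub, sub_mul, star_eq_conjTranspose, Matrix.mul_smul,
      Matrix.smul_mul, Matrix.mul_one, h2]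
  rw [h]
  refine PosSemidef.mul_mul_conjTranspose_same (PosSemidef.diagonal fun i => ?_) _
  simpa using hc i

/-- The constant is the least eigenvalue; over an empty index type there is none, and any constant
works. -/
lemma exists_posSemidef_sub_smul_one [DecidableEq n] {A : Matrix n n ℂ} (hA : A.PosDef) :
    ∃ c : ℝ, 0 < c ∧ (A - (c : ℂ) • 1).PosSemidef := by
  rcases isEmpty_or_nonempty n with h | h
  · refine ⟨1, one_pos, ?_⟩
    convert PosSemidef.zero (n := n) (R := ℂ)
    exact Subsingleton.elim _ _
  · obtain ⟨i, hi⟩ := Finite.exists_min hA.1.eigenvalues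
    exact ⟨_, hA.eigenvalues_pos i, posSemidef_sub_smul_one hA.1 hi⟩

lemma exists_posSemidef_smul_one_sub [DecidableEq n] {A : Matrix n n ℂ} (hA : A.IsHermitian) :
    ∃ c : ℝ, ((c : ℂ) • 1 - A).PosSemidef := by
  rcases isEmpty_or_nonempty n with h | h
  · refine ⟨1, ?_⟩
    convert PosSemidef.zero (n := n) (R := ℂ)
    exact Subsingleton.elim _ _
  · obtain ⟨i, hi⟩ := Finite.exists_min hA.neg.eigenvalues
    refine ⟨-hA.neg.eigenvalues i, ?_⟩
    convert posSemidef_sub_smul_one hA.neg hi using 1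
    push_cast
    rw [neg_smul]
    abel

/-- If `0 ≤ N ≤ G`, then the kernel of `G` is contained in that of `N`. -/
lemma mulVec_eq_zero_of_posSemidef_sub {N G : Matrix n n ℂ} (hN : N.PosSemidef)
    (hG : (G - N).PosSemidef) {v : n → ℂ} (hv : G *ᵥ v = 0) : N *ᵥ v = 0 := by
  -- For positive semidefinite `N` it suffices that `⟨v, N v⟩ = 0`; since `G v = 0`, positivity of
  -- `G - N` gives `-⟨v, N v⟩ ≥ 0`.
  rw [← hN.dotProduct_mulVec_zero_iff]
  refine le_antisymm ?_ (hN.dotProduct_mulVec_nonneg v)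
  have := hG.dotProduct_mulVec_nonneg v
  rwa [sub_mulVec, hv, zero_sub, dotProduct_neg, Left.nonneg_neg_iff] at this

lemma posSemidef_apply_eq_zero_of_diag [DecidableEq n] {N : Matrix n n ℂ} (hN : N.PosSemidef)
    {j : n} (hj : N j j = 0) (i : n) : N i j = 0 := by
  have h := (hN.dotProduct_mulVec_zero_iff (Pi.single j 1)).1 (by simp [hj])
  simpa using congrFun h i

lemma posSemidef_eq_zero_of_diag [DecidableEq n] {N : Matrix n n ℂ} (hN : N.PosSemidef)
    (h : ∀ j, N j j = 0) : N = 0 := by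
  ext i j
  exact posSemidef_apply_eq_zero_of_diag hN (h j) i

/-- `Q` and `1 - Q` are complementary orthogonal projections, so the inverse is obtained by
inverting the two weights. Werner and isotropic states both have this form. -/
lemma posDef_smul_add_smul_one_sub [DecidableEq n] {Q : Matrix n n ℂ} (hQ : Q.IsHermitian)
    (hQ2 : Q * Q = Q) {x y : ℝ} (hx : 0 < x) (hy : 0 < y) :
    ((x : ℂ) • Q + (y : ℂ) • (1 - Q)).PosDef := by
  have hQp : Q.PosSemidef := by
    have := posSemidef_conjTranspose_mul_self Q
    rwa [hQ.eq, hQ2] at this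
  have hQp' : (1 - Q).PosSemidef := by
    have := posSemidef_conjTranspose_mul_self (1 - Q)
    rwa [conjTranspose_sub, conjTranspose_one, hQ.eq, mul_sub, mul_one, sub_mul, one_mul, hQ2,
      sub_self, sub_zero] at this
  rw [PosSemidef.posDef_iff_isUnit]
  · rw [Matrix.isUnit_iff_isUnit_det]
    refine Matrix.isUnit_det_of_right_inverse (B := (x : ℂ)⁻¹ • Q + (y : ℂ)⁻¹ • (1 - Q)) ?_
    have hx' : (x : ℂ) ≠ 0 := by exact_mod_cast hx.ne'
    have hy' : (y : ℂ) ≠ 0 := by exact_mod_cast hy.ne'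
    simp only [mul_add, add_mul, Matrix.smul_mul, Matrix.mul_smul, smul_smul, mul_sub, sub_mul,
      mul_one, one_mul, hQ2, sub_self, smul_zero, sub_zero, add_zero, zero_add,
      inv_mul_cancel₀ hx', inv_mul_cancel₀ hy', one_smul]
    abel
  · exact (hQp.smul (by exact_mod_cast hx.le)).add (hQp'.smul (by exact_mod_cast hy.le))

end PosSemidef

/-! ### Full-rank states -/

section FullRank

lemma IsFullRankState.posDef {n : Type*} [Fintype n] {ρ : Matrix n n ℂ} (h : IsFullRankState ρ) :
    ρ.PosDef := by
  classical
  rw [h.1.1.posDef_iff_isUnit, ← mulVec_injective_iff_isUnit]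
  have h1 : LinearMap.range ρ.mulVecLin = ⊤ := by
    apply Submodule.eq_top_of_finrank_eq
    rw [← Matrix.rank, h.2, Module.finrank_fintype_fun_eq_card]
  exact LinearMap.injective_iff_surjective.2 (LinearMap.range_eq_top.1 h1)

lemma isFullRankState_of_posDef {n : Type*} [Fintype n] {ρ : Matrix n n ℂ} (h : ρ.PosDef)
    (ht : ρ.trace = 1) : IsFullRankState ρ := by
  classical
  exact ⟨⟨h.posSemidef, ht⟩, rank_of_isUnit _ h.isUnit⟩

lemma IsFullRankState.supp_eq_top {n : Type*} [Fintype n] {ρ : Matrix n n ℂ}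
    (h : IsFullRankState ρ) : supp ρ = ⊤ := by
  apply Submodule.eq_top_of_finrank_eq
  rw [supp, ← Matrix.rank, h.2, Module.finrank_fintype_fun_eq_card]

variable {a b : Type*} [Fintype a] [Fintype b]

lemma trace_maxMixed [Nonempty b] [DecidableEq b] : (maxMixed b).trace = 1 := by
  simp [maxMixed, trace_smul]

lemma posSemidef_maxMixed [DecidableEq b] : (maxMixed b).PosSemidef :=
  PosSemidef.one.smul (by simp)

omit [Fintype a] in
lemma trLast_kronecker (A : Matrix a a ℂ) (B : Matrix b b ℂ) :
    trLast (A ⊗ₖ B) = B.trace • A := by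
  ext i j
  simp [trLast, ← Finset.mul_sum, trace, mul_comm]

lemma IsState.nonempty {n : Type*} [Fintype n] {ρ : Matrix n n ℂ} (h : IsState ρ) : Nonempty n := by
  by_contra hn
  rw [not_nonempty_iff] at hn
  simpa using h.2

lemma IsState.isExtension_kronecker_maxMixed [DecidableEq b] {ρ : Matrix (a × b) (a × b) ℂ}
    (h : IsState ρ) : IsExtension ρ (ρ ⊗ₖ maxMixed b) := by
  have : Nonempty b := h.nonempty.map Prod.snd
  refine ⟨⟨h.1.kronecker posSemidef_maxMixed, ?_⟩, ?_⟩
  · rw [trace_kronecker, h.2, trace_maxMixed, one_mul]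
  · rw [trLast_kronecker, trace_maxMixed, one_smul]

lemma IsFullRankState.isSuperTwoExtendible {ρ : Matrix (a × b) (a × b) ℂ}
    (h : IsFullRankState ρ) : IsSuperTwoExtendible ρ := by
  classical
  exact ⟨_, ⟨_, h.1.isExtension_kronecker_maxMixed, rfl⟩, h.supp_eq_top ▸ le_top⟩

lemma tensorPow_mul (n : ℕ) (A B : Matrix (a × b) (a × b) ℂ) :
    tensorPow n (A * B) = tensorPow n A * tensorPow n B := by
  classical
  ext i j
  simp only [tensorPow, of_apply, mul_apply, Finset.prod_univ_sum, Fintype.piFinset_univ,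
    ← Finset.prod_mul_distrib]
  exact Fintype.sum_equiv (Equiv.arrowProdEquivProdArrow (Fin n) (fun _ => a) (fun _ => b)) _ _
    fun _ => rfl

omit [Fintype a] [Fintype b] in
lemma tensorPow_one (n : ℕ) [DecidableEq a] [DecidableEq b] :
    tensorPow n (1 : Matrix (a × b) (a × b) ℂ) = 1 := by
  ext i j
  simp only [tensorPow, of_apply, one_apply, Prod.ext_iff, funext_iff]
  by_cases h : ∀ l, i.1 l = j.1 l ∧ i.2 l = j.2 l
  · rw [if_pos (forall_and.1 h), Finset.prod_eq_one fun l _ => if_pos (h l)]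
  · rw [if_neg (fun h' => h (forall_and.2 h'))]
    obtain ⟨l, hl⟩ := not_forall.1 h
    exact Finset.prod_eq_zero (Finset.mem_univ l) (if_neg hl)

omit [Fintype a] [Fintype b] in
lemma tensorPow_conjTranspose (n : ℕ) (A : Matrix (a × b) (a × b) ℂ) :
    tensorPow n Aᴴ = (tensorPow n A)ᴴ := by
  ext i j
  simp [tensorPow, conjTranspose_apply]

lemma trace_tensorPow (n : ℕ) (A : Matrix (a × b) (a × b) ℂ) :
    (tensorPow n A).trace = A.trace ^ n := by
  classical
  rw [← Fin.prod_const]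
  simp only [trace, diag_apply, tensorPow, of_apply, Finset.prod_univ_sum, Fintype.piFinset_univ]
  exact (Fintype.sum_equiv (Equiv.arrowProdEquivProdArrow (Fin n) (fun _ => a) (fun _ => b)) _ _
    fun _ => rfl).symm

/-- Tensor powers are multiplicative and commute with adjoints: a factorisation `ρ = Bᴴ * B` gives
positivity, and the power of `ρ⁻¹` gives invertibility. -/
lemma posDef_tensorPow (n : ℕ) {ρ : Matrix (a × b) (a × b) ℂ} (h : ρ.PosDef) :
    (tensorPow n ρ).PosDef := by
  classical
  have hu : IsUnit (tensorPow n ρ) := by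
    rw [isUnit_iff_isUnit_det]
    refine isUnit_det_of_right_inverse (B := tensorPow n ρ⁻¹) ?_
    rw [← tensorPow_mul, mul_nonsing_inv _ ((isUnit_iff_isUnit_det _).1 h.isUnit), tensorPow_one]
  refine (PosSemidef.posDef_iff_isUnit ?_).2 hu
  open scoped MatrixOrder in
  obtain ⟨B, rfl⟩ := CStarAlgebra.nonneg_iff_eq_star_mul_self.mp h.posSemidef.nonneg
  rw [star_eq_conjTranspose, tensorPow_mul, tensorPow_conjTranspose]
  exact posSemidef_conjTranspose_mul_self _

end FullRank

/-! ### Werner and isotropic states -/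

section Examples

variable (d : ℕ)

lemma swapOp_apply (x y : Fin d × Fin d) :
    swapOp d x y = if x.1 = y.2 ∧ x.2 = y.1 then 1 else 0 := by
  -- Nested single-condition `if`s let each delta collapse one sum.
  have : swapOp d x y = ∑ i, ∑ j,
      (if i = x.1 then if j = y.1 then if j = x.2 then if i = y.2 then (1 : ℂ) else 0 else 0 else 0
        else 0) := by
    simp only [swapOp, Matrix.sum_apply]
    refine Finset.sum_congr rfl fun i _ => Finset.sum_congr rfl fun j _ => ?_
    split_ifs <;> simp_all
  rw [this]
  simp only [Finset.sum_ite_irrel, Finset.sum_const_zero, Finset.sum_ite_eq', Finset.mem_univ,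
    if_true]
  grind

lemma isHermitian_swapOp : (swapOp d).IsHermitian := by
  ext x y
  simp only [conjTranspose_apply, swapOp_apply, apply_ite star, star_one, star_zero]
  grind

lemma swapOp_mul_self : swapOp d * swapOp d = 1 := by
  ext x y
  rw [mul_apply, Finset.sum_eq_single (x.2, x.1)]
  · simp only [swapOp_apply, one_apply, Prod.ext_iff]
    grind
  · intro z _ hz
    rw [swapOp_apply, if_neg, zero_mul]
    rintro ⟨h1, h2⟩
    exact hz (Prod.ext h2.symm h1.symm)
  · simp

lemma trace_swapOp : (swapOp d).trace = d := by
  simp only [trace, diag_apply, swapOp_apply, Fintype.sum_prod_type]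
  have : ∀ x y : Fin d, (if x = y ∧ y = x then (1 : ℂ) else 0) = if x = y then 1 else 0 := by
    intro x y
    grind
  simp [this]

lemma maxEntangled_apply (x y : Fin d × Fin d) :
    maxEntangled d x y = (d : ℂ)⁻¹ * if x.1 = x.2 ∧ y.1 = y.2 then 1 else 0 := by
  have : maxEntangled d x y = (d : ℂ)⁻¹ * ∑ i, ∑ j,
      (if i = x.1 then if j = y.1 then if i = x.2 then if j = y.2 then (1 : ℂ) else 0 else 0 else 0
        else 0) := by
    simp only [maxEntangled, Matrix.smul_apply, smul_eq_mul, Matrix.sum_apply]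
    congr 1
    refine Finset.sum_congr rfl fun i _ => Finset.sum_congr rfl fun j _ => ?_
    split_ifs <;> simp_all
  rw [this]
  simp only [Finset.sum_ite_irrel, Finset.sum_const_zero, Finset.sum_ite_eq', Finset.mem_univ,
    if_true]
  grind

lemma isHermitian_maxEntangled : (maxEntangled d).IsHermitian := by
  ext x y
  simp only [conjTranspose_apply, maxEntangled_apply, star_mul', apply_ite star, star_one,
    star_zero, star_inv₀, star_natCast]
  grind

variable {d}

lemma maxEntangled_mul_self (hd : d ≠ 0) : maxEntangled d * maxEntangled d = maxEntangled d := by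
  have hd' : (d : ℂ) ≠ 0 := by exact_mod_cast hd
  ext x y
  simp only [mul_apply, maxEntangled_apply, Fintype.sum_prod_type]
  by_cases hx : x.1 = x.2 <;> by_cases hy : y.1 = y.2 <;> simp [hx, hy, hd']

lemma trace_maxEntangled (hd : d ≠ 0) : (maxEntangled d).trace = 1 := by
  have hd' : (d : ℂ) ≠ 0 := by exact_mod_cast hd
  simp [trace, maxEntangled_apply, Fintype.sum_prod_type, hd']

lemma isFullRankState_werner {p : ℝ} (hd : 2 ≤ d) (hp : 0 < p) (hp1 : p < 1) :
    IsFullRankState (werner p d) := by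
  have hd' : (2 : ℝ) ≤ d := by exact_mod_cast hd
  have hd0 : (d : ℂ) ≠ 0 := by
    norm_cast
    omega
  have hd1 : (d : ℂ) + 1 ≠ 0 := by
    norm_cast
  have hd2 : (d : ℂ) - 1 ≠ 0 := by
    rw [sub_ne_zero]
    norm_cast
    omega
  refine isFullRankState_of_posDef ?_ ?_
  -- `Q` projects onto the symmetric subspace; the factors `2` compensate for its normalisation.
  · have h := posDef_smul_add_smul_one_sub (Q := (2 : ℂ)⁻¹ • (1 + swapOp d))
      (x := 2 * (p / (d * (d + 1)))) (y := 2 * ((1 - p) / (d * (d - 1)))) ?_ ?_ ?_ ?_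
    · convert h using 1
      rw [werner]
      have h2 : (1 : Matrix (Fin d × Fin d) (Fin d × Fin d) ℂ) - (2 : ℂ)⁻¹ • (1 + swapOp d)
          = (2 : ℂ)⁻¹ • (1 - swapOp d) := by
        ext x y
        simp only [Matrix.sub_apply, Matrix.smul_apply, Matrix.add_apply, smul_eq_mul]
        ring
      rw [h2, smul_smul, smul_smul]
      congr 2 <;> push_cast <;> ring
    · rw [IsHermitian, conjTranspose_smul, conjTranspose_add, conjTranspose_one,
        (isHermitian_swapOp d).eq]
      simp
    · rw [Matrix.smul_mul, Matrix.mul_smul, smul_smul, mul_add, add_mul, add_mul, swapOp_mul_self]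
      simp only [mul_one, one_mul]
      ext x y
      simp only [Matrix.smul_apply, Matrix.add_apply, smul_eq_mul]
      ring
    · positivity
    · have : 0 < 1 - p := by linarith
      have : 0 < (d : ℝ) - 1 := by linarith
      positivity
  · simp only [werner, trace_add, trace_smul, trace_sub, trace_swapOp, trace_one, smul_eq_mul,
      Fintype.card_prod, Fintype.card_fin]
    push_cast
    field_simp
    ring

lemma isFullRankState_isotropic {F : ℝ} (hd : 2 ≤ d) (hF : 0 < F) (hF1 : F < 1) :
    IsFullRankState (isotropic F d) := by
  have hd' : (2 : ℝ) ≤ d := by exact_mod_cast hd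
  have hd0 : d ≠ 0 := by omega
  have h1 : 0 < (d : ℝ) ^ 2 - 1 := by nlinarith
  have h2 : 0 < 1 - F := by linarith
  refine isFullRankState_of_posDef (posDef_smul_add_smul_one_sub (isHermitian_maxEntangled d)
    (maxEntangled_mul_self hd0) hF (by positivity)) ?_
  have h3 : (d : ℂ) ^ 2 - 1 ≠ 0 := by exact_mod_cast h1.ne'
  simp only [isotropic, trace_add, trace_smul, trace_sub, trace_maxEntangled hd0, trace_one,
    smul_eq_mul, Fintype.card_prod, Fintype.card_fin]
  push_cast
  rw [← sq]
  field_simp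
  ring

end Examples

/-! ### Positivity of one-way LOCC channels -/

section LOCC

variable {a b a' b' c : Type*}

/-- Reindexing by `Fintype.equivFin` passes from the ancillas `Fin r` to an arbitrary finite
ancilla. -/
lemma IsCP.posSemidef_mapRight [Fintype c] {Φ : Matrix b b ℂ →ₗ[ℂ] Matrix b' b' ℂ} (h : IsCP Φ)
    {M : Matrix (c × b) (c × b) ℂ} (hM : M.PosSemidef) : (mapRight c Φ M).PosSemidef := by
  have := (h _ _ (hM.submatrix (Prod.map (Fintype.equivFin c).symm id))).submatrix
    (Prod.map (Fintype.equivFin c) id)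
  convert this using 1
  ext x y
  simp [mapRight]

lemma IsCP.posSemidef_mapLeft [Fintype c] {Φ : Matrix a a ℂ →ₗ[ℂ] Matrix a' a' ℂ} (h : IsCP Φ)
    {M : Matrix (a × c) (a × c) ℂ} (hM : M.PosSemidef) : (mapLeft c Φ M).PosSemidef :=
  (h.posSemidef_mapRight (hM.submatrix Prod.swap)).submatrix Prod.swap

lemma IsCP.posSemidef_apply {Φ : Matrix a a ℂ →ₗ[ℂ] Matrix a' a' ℂ} (h : IsCP Φ)
    {M : Matrix a a ℂ} (hM : M.PosSemidef) : (Φ M).PosSemidef :=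
  (h.posSemidef_mapRight (c := Unit) (hM.submatrix Prod.snd)).submatrix fun x => ((), x)

lemma tensorMap_kronecker (Φ : Matrix a a ℂ →ₗ[ℂ] Matrix a' a' ℂ)
    (Ψ : Matrix b b ℂ →ₗ[ℂ] Matrix b' b' ℂ) (A : Matrix a a ℂ) (B : Matrix b b ℂ) :
    tensorMap Φ Ψ (A ⊗ₖ B) = Φ A ⊗ₖ Ψ B := by
  have h1 : ∀ x y, (Matrix.of fun i j => (A ⊗ₖ B) (i, x) (j, y)) = B x y • A := by
    intro x y
    ext i j
    simp [mul_comm]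
  ext p q
  have h2 : (Matrix.of fun i j => mapLeft b Φ (A ⊗ₖ B) (p.1, i) (q.1, j))
      = Φ A p.1 q.1 • B := by
    ext i j
    simp only [mapLeft, LinearMap.coe_mk, AddHom.coe_mk, of_apply, h1, map_smul, Matrix.smul_apply,
      smul_eq_mul, mul_comm]
  simp only [tensorMap, LinearMap.comp_apply, mapRight, LinearMap.coe_mk, AddHom.coe_mk, of_apply]
  rw [h2, map_smul]
  rfl

variable [Fintype a] [Fintype b] [Fintype a'] [Fintype b']

lemma IsOneWayLOCC.posSemidef {L : Matrix (a × b) (a × b) ℂ →ₗ[ℂ] Matrix (a' × b') (a' × b') ℂ}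
    (hL : IsOneWayLOCC L) {M : Matrix (a × b) (a × b) ℂ} (hM : M.PosSemidef) :
    (L M).PosSemidef := by
  obtain ⟨m, E, D, hE, -, hD, rfl⟩ := hL
  rw [LinearMap.sum_apply]
  exact posSemidef_sum _ fun x _ =>
    (hD x).1.posSemidef_mapRight ((hE x).posSemidef_mapLeft hM)

/-- A one-way LOCC channel sends the identity to a separable operator. -/
lemma IsOneWayLOCC.exists_apply_one [DecidableEq a] [DecidableEq b]
    {L : Matrix (a × b) (a × b) ℂ →ₗ[ℂ] Matrix (a' × b') (a' × b') ℂ} (hL : IsOneWayLOCC L) :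
    ∃ (m : ℕ) (P : Fin m → Matrix a' a' ℂ) (Q : Fin m → Matrix b' b' ℂ),
      (∀ x, (P x).PosSemidef) ∧ (∀ x, (Q x).PosSemidef) ∧ L 1 = ∑ x, P x ⊗ₖ Q x := by
  obtain ⟨m, E, D, hE, -, hD, rfl⟩ := hL
  refine ⟨m, fun x => E x 1, fun x => D x 1, fun x => (hE x).posSemidef_apply PosSemidef.one,
    fun x => (hD x).1.posSemidef_apply PosSemidef.one, ?_⟩
  rw [LinearMap.sum_apply, ← one_kronecker_one]
  exact Finset.sum_congr rfl fun x _ => tensorMap_kronecker _ _ _ _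

/-- Discard the input and prepare `τ`. -/
def discardPrepare (n : Type*) [Fintype n] {m : Type*} (τ : Matrix m m ℂ) :
    Matrix n n ℂ →ₗ[ℂ] Matrix m m ℂ :=
  (traceLinearMap n ℂ ℂ).smulRight τ

lemma discardPrepare_apply {n m : Type*} [Fintype n] (τ : Matrix m m ℂ) (M : Matrix n n ℂ) :
    discardPrepare n τ M = M.trace • τ := rfl

lemma isCP_discardPrepare {n m : Type*} [Fintype n] [Finite m] {τ : Matrix m m ℂ}
    (hτ : τ.PosSemidef) : IsCP (discardPrepare n τ) := by
  intro r M hM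
  -- The output is the partial trace of `M`, written as a sum of principal submatrices, tensored
  -- with `τ`.
  have : mapRight (Fin r) (discardPrepare n τ) M
      = ∑ x, M.submatrix (fun i => (i, x)) (fun i => (i, x)) ⊗ₖ τ := by
    ext p q
    simp [mapRight, discardPrepare_apply, trace, Matrix.sum_apply, Finset.sum_mul]
  rw [this]
  exact posSemidef_sum _ fun x _ => (hM.submatrix _).kronecker hτ

lemma isTP_discardPrepare {n m : Type*} [Fintype n] [Fintype m] {τ : Matrix m m ℂ}
    (hτ : IsState τ) : IsTP (discardPrepare n τ) := fun M => by
  rw [discardPrepare_apply, trace_smul, hτ.2, smul_eq_mul, mul_one]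

omit [Fintype a'] [Fintype b'] in
lemma tensorMap_discardPrepare (σ : Matrix a' a' ℂ) (τ : Matrix b' b' ℂ)
    (M : Matrix (a × b) (a × b) ℂ) :
    tensorMap (discardPrepare a σ) (discardPrepare b τ) M = M.trace • (σ ⊗ₖ τ) := by
  ext p q
  simp only [tensorMap, LinearMap.comp_apply, mapRight, mapLeft, LinearMap.coe_mk, AddHom.coe_mk,
    of_apply, discardPrepare_apply, trace, diag_apply, Matrix.smul_apply, smul_eq_mul,
    kroneckerMap_apply, Fintype.sum_prod_type, ← Finset.sum_mul]
  rw [Finset.sum_comm, mul_assoc]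

lemma isOneWayLOCC_discardPrepare {σ : Matrix a' a' ℂ} {τ : Matrix b' b' ℂ}
    (hσ : IsState σ) (hτ : IsState τ) :
    IsOneWayLOCC (tensorMap (discardPrepare a σ) (discardPrepare b τ)) :=
  ⟨1, fun _ => discardPrepare a σ, fun _ => discardPrepare b τ,
    fun _ => isCP_discardPrepare hσ.1, by simpa using isTP_discardPrepare hσ,
    fun _ => ⟨isCP_discardPrepare hτ.1, isTP_discardPrepare hτ⟩, by simp⟩

end LOCC

/-! ### Product operators below private states -/

section Private

variable {k s t : ℕ}

/-- The twisting `∑ i, |ii⟩ ⊗ U i` as a map from the shield systems to all systems. -/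
def twist (U : Fin k → Matrix.unitaryGroup (Fin s × Fin t) ℂ) :
    Matrix ((Fin k × Fin s) × (Fin k × Fin t)) (Fin s × Fin t) ℂ :=
  Matrix.of fun x y => if x.1.1 = x.2.1 then
    (U x.1.1 : Matrix (Fin s × Fin t) (Fin s × Fin t) ℂ) (x.1.2, x.2.2) y else 0

/-- In this factored form the kernel of `(twist U)ᴴ` visibly lies in that of the private state. -/
lemma privateOp_eq (U : Fin k → Matrix.unitaryGroup (Fin s × Fin t) ℂ)
    (ω : Matrix (Fin s × Fin t) (Fin s × Fin t) ℂ) :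
    privateOp U ω = (k : ℂ)⁻¹ • (twist U * ω * (twist U)ᴴ) := by
  rw [privateOp]
  congr 1
  ext x y
  have h1 : (twist U * ω * (twist U)ᴴ) x y = if x.1.1 = x.2.1 then if y.1.1 = y.2.1 then
      ((U x.1.1 : Matrix (Fin s × Fin t) (Fin s × Fin t) ℂ) * ω *
        (U y.1.1 : Matrix (Fin s × Fin t) (Fin s × Fin t) ℂ)ᴴ) (x.1.2, x.2.2) (y.1.2, y.2.2)
        else 0 else 0 := by
    by_cases hx : x.1.1 = x.2.1 <;> by_cases hy : y.1.1 = y.2.1 <;>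
      simp [mul_apply, twist, conjTranspose_apply, hx, hy]
  rw [h1]
  have h2 : ∀ i j : Fin k, ((Matrix.single (i, i) (j, j) (1 : ℂ) ⊗ₖ
        ((U i : Matrix (Fin s × Fin t) (Fin s × Fin t) ℂ) * ω *
          (U j : Matrix (Fin s × Fin t) (Fin s × Fin t) ℂ)ᴴ)).submatrix
      (Equiv.prodProdProdComm (Fin k) (Fin s) (Fin k) (Fin t))
      (Equiv.prodProdProdComm (Fin k) (Fin s) (Fin k) (Fin t))) x y =
      if i = x.1.1 then if j = y.1.1 then if i = x.2.1 then if j = y.2.1 then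
      ((U i : Matrix (Fin s × Fin t) (Fin s × Fin t) ℂ) * ω *
        (U j : Matrix (Fin s × Fin t) (Fin s × Fin t) ℂ)ᴴ) (x.1.2, x.2.2) (y.1.2, y.2.2)
        else 0 else 0 else 0 else 0 := by
    intro i j
    simp only [submatrix_apply, kronecker_apply, single_apply, Equiv.prodProdProdComm_apply]
    split_ifs <;> simp_all
  simp only [Matrix.sum_apply, h2, Finset.sum_ite_irrel, Finset.sum_const_zero, Finset.sum_ite_eq',
    Finset.mem_univ, if_true]

/-- The vector `|ll⟩ ⊗ y`. -/
def keyVec (l : Fin k) (y : Fin s × Fin t → ℂ) : (Fin k × Fin s) × (Fin k × Fin t) → ℂ :=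
  fun x => if x.1.1 = l ∧ x.2.1 = l then y (x.1.2, x.2.2) else 0

lemma sum_key_shield {M : Type*} [AddCommMonoid M]
    (f : (Fin k × Fin s) × (Fin k × Fin t) → M) :
    ∑ x, f x = ∑ i, ∑ j, ∑ z : Fin s × Fin t, f ((i, z.1), (j, z.2)) := by
  rw [← Equiv.sum_comp (Equiv.prodProdProdComm (Fin k) (Fin k) (Fin s) (Fin t)),
    Fintype.sum_prod_type, Fintype.sum_prod_type]
  rfl

/-- The key value is forgotten up to the unitary `U l`, so suitable vectors with different key
values have the same image and their difference lies in the kernel. -/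
lemma twist_conjTranspose_mulVec_keyVec (U : Fin k → Matrix.unitaryGroup (Fin s × Fin t) ℂ)
    (l : Fin k) (y : Fin s × Fin t → ℂ) :
    (twist U)ᴴ *ᵥ keyVec l y
      = (U l : Matrix (Fin s × Fin t) (Fin s × Fin t) ℂ)ᴴ *ᵥ y := by
  ext w
  simp only [mulVec, dotProduct, sum_key_shield, conjTranspose_apply, twist, of_apply, keyVec]
  rw [Finset.sum_eq_single l, Finset.sum_eq_single l]
  · simp
  · intro j _ hj
    simp [hj]
  · simp
  · intro i _ hi
    simp [hi]
  · simp

lemma twist_conjTranspose_mul_self (U : Fin k → Matrix.unitaryGroup (Fin s × Fin t) ℂ) :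
    (twist U)ᴴ * twist U = (k : ℂ) • 1 := by
  have h : (twist U)ᴴ * twist U = ∑ l, (U l : Matrix (Fin s × Fin t) (Fin s × Fin t) ℂ)ᴴ *
      (U l : Matrix (Fin s × Fin t) (Fin s × Fin t) ℂ) := by
    ext w z
    simp only [mul_apply, sum_key_shield, conjTranspose_apply, twist, of_apply, Matrix.sum_apply]
    refine Finset.sum_congr rfl fun i _ => ?_
    rw [Finset.sum_eq_single i]
    · simp
    · intro j _ hj
      simp [hj.symm]
    · simp
  have hU : ∀ l, (U l : Matrix (Fin s × Fin t) (Fin s × Fin t) ℂ)ᴴ *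
      (U l : Matrix (Fin s × Fin t) (Fin s × Fin t) ℂ) = 1 :=
    fun l => Unitary.coe_star_mul_self (U l)
  rw [h]
  simp only [hU, Finset.sum_const, Finset.card_univ, Fintype.card_fin]
  exact (Nat.cast_smul_eq_nsmul ℂ k _).symm

lemma IsPrivateState.trace_eq_one
    {γ : Matrix ((Fin k × Fin s) × (Fin k × Fin t)) ((Fin k × Fin s) × (Fin k × Fin t)) ℂ}
    (h : IsPrivateState γ) (hk : k ≠ 0) : γ.trace = 1 := by
  obtain ⟨U, ω, hω, rfl⟩ := h
  rw [privateOp_eq, trace_smul, trace_mul_cycle, twist_conjTranspose_mul_self, Matrix.smul_mul,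
    one_mul, trace_smul, hω.2, smul_eq_mul, smul_eq_mul, mul_one,
    inv_mul_cancel₀ (by exact_mod_cast hk)]

lemma privateOp_mulVec_eq_zero (U : Fin k → Matrix.unitaryGroup (Fin s × Fin t) ℂ)
    (ω : Matrix (Fin s × Fin t) (Fin s × Fin t) ℂ)
    {v : (Fin k × Fin s) × (Fin k × Fin t) → ℂ} (hv : (twist U)ᴴ *ᵥ v = 0) :
    privateOp U ω *ᵥ v = 0 := by
  rw [privateOp_eq, smul_mulVec, ← mulVec_mulVec, hv, mulVec_zero, smul_zero]

/-- The support of a private state with at least two key values contains no product vector: no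
nonzero product operator is dominated by a multiple of it. -/
lemma IsPrivateState.kronecker_eq_zero
    {γ : Matrix ((Fin k × Fin s) × (Fin k × Fin t)) ((Fin k × Fin s) × (Fin k × Fin t)) ℂ}
    (h : IsPrivateState γ) (hk : 2 ≤ k) {P : Matrix (Fin k × Fin s) (Fin k × Fin s) ℂ}
    {Q : Matrix (Fin k × Fin t) (Fin k × Fin t) ℂ} (hP : P.PosSemidef) (hQ : Q.PosSemidef)
    {c : ℂ} (hle : (c • γ - P ⊗ₖ Q).PosSemidef) : P ⊗ₖ Q = 0 := by
  obtain ⟨U, ω, -, rfl⟩ := h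
  have hN := hP.kronecker hQ
  have hker : ∀ v, (twist U)ᴴ *ᵥ v = 0 → (P ⊗ₖ Q) *ᵥ v = 0 := fun v hv =>
    mulVec_eq_zero_of_posSemidef_sub hN hle (by
      rw [smul_mulVec, privateOp_mulVec_eq_zero U ω hv, smul_zero])
  -- Basis vectors with disagreeing key values are killed by `(twist U)ᴴ`.
  have hoff : ∀ (i j : Fin k) (y : Fin s) (z : Fin t), i ≠ j →
      P (i, y) (i, y) * Q (j, z) (j, z) = 0 := by
    intro i j y z hij
    have h1 := hker (Pi.single ((i, y), (j, z)) 1) (by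
      ext w
      simp [twist, hij])
    simpa using congrFun h1 ((i, y), (j, z))
  have hdiag : ∀ (i : Fin k) (y : Fin s) (z : Fin t), P (i, y) (i, y) * Q (i, z) (i, z) = 0 := by
    intro i y z
    by_contra hne
    have : Nontrivial (Fin k) := Fin.nontrivial_iff_two_le.2 hk
    obtain ⟨j, hj⟩ := exists_ne i
    have hQj : ∀ z', Q (j, z') (j, z') = 0 := fun z' =>
      (mul_eq_zero.1 (hoff i j y z' hj.symm)).resolve_left (left_ne_zero_of_mul hne)
    set u : Fin s × Fin t → ℂ := Pi.single (y, z) 1 with hu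
    -- Chosen so that `|ii⟩ ⊗ u` and `|jj⟩ ⊗ w` have the same image under `(twist U)ᴴ`. As `P ⊗ Q`
    -- kills the latter by `hQj`, it must kill the former.
    set w : Fin s × Fin t → ℂ := (U j : Matrix (Fin s × Fin t) (Fin s × Fin t) ℂ) *ᵥ
      ((U i : Matrix (Fin s × Fin t) (Fin s × Fin t) ℂ)ᴴ *ᵥ u) with hw
    have hUj : (U j : Matrix (Fin s × Fin t) (Fin s × Fin t) ℂ)ᴴ *
      (U j : Matrix (Fin s × Fin t) (Fin s × Fin t) ℂ) = 1 := Unitary.coe_star_mul_self (U j)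
    have h1 := hker (keyVec i u - keyVec j w) (by
      rw [mulVec_sub, twist_conjTranspose_mulVec_keyVec, twist_conjTranspose_mulVec_keyVec, hw,
        mulVec_mulVec _ (U j : Matrix (Fin s × Fin t) (Fin s × Fin t) ℂ)ᴴ, hUj, one_mulVec,
        sub_self])
    have h2 : (P ⊗ₖ Q) *ᵥ keyVec j w = 0 := by
      ext x
      simp only [mulVec, dotProduct]
      refine Finset.sum_eq_zero fun x' _ => ?_
      by_cases hx : x'.1.1 = j ∧ x'.2.1 = j
      · rw [posSemidef_apply_eq_zero_of_diag hN, zero_mul]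
        rw [kronecker_apply]
        have := hQj x'.2.2
        rw [← hx.2] at this
        rw [show x'.2 = (x'.2.1, x'.2.2) from rfl, this, mul_zero]
      · rw [keyVec, if_neg hx, mul_zero]
    have h3 : keyVec i u = Pi.single ((i, y), (i, z)) 1 := by
      ext x
      simp only [keyVec, hu, Pi.single_apply, Prod.ext_iff]
      grind
    rw [mulVec_sub, h2, sub_zero, h3] at h1
    apply hne
    simpa using congrFun h1 ((i, y), (i, z))
  refine posSemidef_eq_zero_of_diag hN ?_
  rintro ⟨⟨i, y⟩, ⟨j, z⟩⟩
  rw [kronecker_apply]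
  by_cases hij : i = j
  · subst hij
    exact hdiag i y z
  · exact hoff i j y z hij

end Private

/-! ### Vanishing of the distillable key -/

section Key

variable {a b : Type*} [Fintype a] [Fintype b]

lemma eq_zero_or_le_one_of_distill {ρ : Matrix (a × b) (a × b) ℂ} (hρ : ρ.PosDef) {p : ℝ}
    {k s t : ℕ}
    {L : Matrix (a × b) (a × b) ℂ →ₗ[ℂ]
      Matrix ((Fin 2 × (Fin k × Fin s)) × (Fin k × Fin t))
        ((Fin 2 × (Fin k × Fin s)) × (Fin k × Fin t)) ℂ}
    {γ τ : Matrix ((Fin k × Fin s) × (Fin k × Fin t)) ((Fin k × Fin s) × (Fin k × Fin t)) ℂ}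
    (hp : 0 ≤ p) (hL : IsOneWayLOCC L) (hγ : IsPrivateState γ) {q : ℂ}
    (h : L ρ = (p : ℂ) • flagged 1 γ + q • flagged 0 τ) : p = 0 ∨ k ≤ 1 := by
  classical
  by_contra! hcon
  obtain ⟨hp0, hk⟩ := hcon
  -- Restricting to the image of `e` extracts the flag-`1` block and discards the failure branch.
  set e : (Fin k × Fin s) × (Fin k × Fin t) → (Fin 2 × (Fin k × Fin s)) × (Fin k × Fin t) :=
    fun x => ((1, x.1), x.2) with he
  have hflag : (L ρ).submatrix e e = (p : ℂ) • γ := by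
    ext x y
    simp [h, flagged, he]
  obtain ⟨c, hc, hlow⟩ := exists_posSemidef_sub_smul_one hρ
  obtain ⟨C, hup⟩ := exists_posSemidef_smul_one_sub hρ.1
  have hlow' := (hL.posSemidef hlow).submatrix e
  have hup' := (hL.posSemidef hup).submatrix e
  rw [map_sub, map_smul, submatrix_sub, Pi.sub_apply, Pi.sub_apply, hflag] at hlow' hup'
  obtain ⟨m, P, Q, hP, hQ, h1⟩ := hL.exists_apply_one
  have h1' : (L 1).submatrix e e = ∑ x, (P x).submatrix (Prod.mk 1) (Prod.mk 1) ⊗ₖ Q x := by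
    rw [h1]
    ext x y
    simp [Matrix.sum_apply, he]
  have hc' : (c : ℂ) ≠ 0 := by exact_mod_cast hc.ne'
  have hzero : ∀ x, (P x).submatrix (Prod.mk 1) (Prod.mk 1) ⊗ₖ Q x = 0 := by
    intro x
    refine hγ.kronecker_eq_zero hk ((hP x).submatrix _) (hQ x) (c := (c : ℂ)⁻¹ * p) ?_
    have h2 : (((c : ℂ)⁻¹ * p) • γ - (L 1).submatrix e e).PosSemidef := by
      have h3 := hlow'.smul (a := (c : ℂ)⁻¹) (by
        rw [← Complex.ofReal_inv]
        exact_mod_cast (inv_pos.2 hc).le)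
      rw [smul_sub, smul_smul, submatrix_smul, Pi.smul_apply, Pi.smul_apply, smul_smul,
        inv_mul_cancel₀ hc', one_smul] at h3
      exact h3
    -- Adding back the other positive summands leaves a single product operator below the multiple
    -- of `γ`.
    have h4 : (∑ y ∈ Finset.univ.erase x,
        (P y).submatrix (Prod.mk 1) (Prod.mk 1) ⊗ₖ Q y).PosSemidef :=
      posSemidef_sum _ fun y _ => ((hP y).submatrix _).kronecker (hQ y)
    rw [h1', ← Finset.add_sum_erase _ _ (Finset.mem_univ x)] at h2
    convert h2.add h4 using 1
    abel
  -- The block of `L 1` is zero, so the upper bound on `ρ` becomes positivity of `-p γ`, whatever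
  -- the sign of `C`.
  rw [submatrix_smul, Pi.smul_apply, Pi.smul_apply, h1',
    Finset.sum_eq_zero fun x _ => hzero x, smul_zero, zero_sub] at hup'
  have htr := hup'.trace_nonneg
  rw [trace_neg, trace_smul, hγ.trace_eq_one (by omega), smul_eq_mul, mul_one] at htr
  have : (0 : ℝ) ≤ -p := by exact_mod_cast htr
  exact hp0 (by linarith)

/-- A supremum in `EReal` over an empty set would be `⊥`, so a protocol must be exhibited: discard
the input and prepare the trivial private state with `k = 1`. -/
lemma zero_mem_achievableKey {ρ : Matrix (a × b) (a × b) ℂ} (hρ : ρ.trace = 1) :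
    (0 : EReal) ∈ achievableKey ρ := by
  have hω : IsState (1 : Matrix (Fin 1 × Fin 1) (Fin 1 × Fin 1) ℂ) :=
    ⟨PosSemidef.one, by simp⟩
  have hσ : IsState (Matrix.single (1, 0) (1, 0) 1 :
      Matrix (Fin 2 × (Fin 1 × Fin 1)) (Fin 2 × (Fin 1 × Fin 1)) ℂ) := by
    refine ⟨?_, by simp⟩
    rw [← diagonal_single]
    exact PosSemidef.diagonal (Pi.single_nonneg.2 zero_le_one)
  refine ⟨1, 1, 1, 1, tensorMap (discardPrepare a (Matrix.single (1, 0) (1, 0) 1))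
    (discardPrepare b 1), privateOp (fun _ => 1) 1, zero_le_one, le_rfl, le_rfl,
    isOneWayLOCC_discardPrepare hσ hω, ⟨_, _, hω, rfl⟩, ?_, by simp⟩
  rw [tensorMap_discardPrepare, hρ]
  ext ⟨⟨f, x⟩, y⟩ ⟨⟨g, x'⟩, y'⟩
  obtain rfl := Subsingleton.elim x 0
  obtain rfl := Subsingleton.elim y 0
  obtain rfl := Subsingleton.elim x' 0
  obtain rfl := Subsingleton.elim y' 0
  simp [privateOp, flagged, single_apply]

lemma oneShotKey_eq_zero {ρ : Matrix (a × b) (a × b) ℂ} (hρ : ρ.PosDef) (ht : ρ.trace = 1) :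
    oneShotKey ρ = 0 := by
  refine le_antisymm (sSup_le ?_) (le_sSup (zero_mem_achievableKey ht))
  rintro r ⟨p, k, s, t, L, γ, hp, -, hk, hL, hγ, h, rfl⟩
  rcases eq_zero_or_le_one_of_distill hρ hp hL hγ h with rfl | hk1
  · simp
  · obtain rfl : k = 1 := le_antisymm hk1 hk
    simp

lemma IsFullRankState.distillableKey_eq_zero {ρ : Matrix (a × b) (a × b) ℂ}
    (h : IsFullRankState ρ) : distillableKey ρ = 0 := by
  have : ∀ n, oneShotKey (tensorPow n ρ) = 0 := fun n =>
    oneShotKey_eq_zero (posDef_tensorPow n h.posDef) (by rw [trace_tensorPow, h.1.2, one_pow])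
  simp [distillableKey, this]

end Key

end OneWayKey

end

theorem corollary2 :
    (∀ (a b : Type*) [Fintype a] [Fintype b] [DecidableEq b] (ρ : Matrix (a × b) (a × b) ℂ),
      OneWayKey.IsFullRankState ρ →
        (OneWayKey.IsExtension ρ (Matrix.kronecker ρ (OneWayKey.maxMixed b)) ∧
          OneWayKey.supp
              (OneWayKey.trMiddle (Matrix.kronecker ρ (OneWayKey.maxMixed b))) ≤
            OneWayKey.supp ρ) ∧
        OneWayKey.IsSuperTwoExtendible ρ ∧
        OneWayKey.distillableKey ρ = 0) ∧
    (∀ (d : ℕ) (p : ℝ), 2 ≤ d → 0 < p → p < 1 →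
      OneWayKey.IsFullRankState (OneWayKey.werner p d) ∧
      OneWayKey.IsSuperTwoExtendible (OneWayKey.werner p d) ∧
      OneWayKey.distillableKey (OneWayKey.werner p d) = 0) ∧
    (∀ (d : ℕ) (F : ℝ), 2 ≤ d → 0 < F → F < 1 →
      OneWayKey.IsFullRankState (OneWayKey.isotropic F d) ∧
      OneWayKey.IsSuperTwoExtendible (OneWayKey.isotropic F d) ∧
      OneWayKey.distillableKey (OneWayKey.isotropic F d) = 0) := by
  refine ⟨fun a b _ _ _ ρ h => ⟨⟨h.1.isExtension_kronecker_maxMixed, ?_⟩,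
    h.isSuperTwoExtendible, h.distillableKey_eq_zero⟩, fun d p hd hp hp1 => ?_,
    fun d F hd hF hF1 => ?_⟩
  · rw [h.supp_eq_top]
    exact le_top
  · have h := OneWayKey.isFullRankState_werner hd hp hp1
    exact ⟨h, h.isSuperTwoExtendible, h.distillableKey_eq_zero⟩
  · have h := OneWayKey.isFullRankState_isotropic hd hF hF1
    exact ⟨h, h.isSuperTwoExtendible, h.distillableKey_eq_zero⟩
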